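/- Let $n\ge 3$, $\mu_0\in\mathbb{R}$ and $\sigma_0\ge 0$. The Gaussian recursive training process $\{(M_k,\Sigma_k)\}_{k\ge0}$ with $n$ samples per round is defined by $M_0=\mu_0$, $\Sigma_0=\sigma_0$ and, for each $k\ge1$: given $M_{k-1}=\mu$ and $\Sigma_{k-1}=\sigma$, the samples $X_{k,1},\ldots,X_{k,n}$ are i.i.d. $N(\mu,\sigma^2)$ (a point mass at $\mu$ if $\sigma=0$), and $$M_k=\frac1n\sum_{i=1}^n X_{k,i},\qquad \Sigma_k=\Big(\frac{1}{n-1}\sum_{i=1}^n (X_{k,i}-M_k)^2\Big)^{1/2}.$$ Then for every integer $k\ge0$ and every $\epsilon>0$, $$\Pr(\Sigma_k>\epsilon)\le\frac{\sigma_0}{\epsilon}\exp\left\{-\frac{k}{4n-1}\right\},$$ and $\Sigma_k\to0$ almost surely as $k\to\infty$. -/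

import Mathlib

open MeasureTheory ProbabilityTheory Filter Topology

noncomputable section

/-- The sample mean `(x₁ + ⋯ + xₙ) / n`. -/
def sampleMean {n : ℕ} (x : Fin n → ℝ) : ℝ :=
  (∑ i, x i) / (n : ℝ)

/-- The unbiased sample variance `(∑ᵢ (xᵢ - x̄)²) / (n - 1)`. -/
def sampleVariance {n : ℕ} (x : Fin n → ℝ) : ℝ :=
  (∑ i, (x i - sampleMean x) ^ 2) / ((n : ℝ) - 1)

/-- The law of `n` independent `N(μ, σ²)` random variables. -/
def iidGaussian (n : ℕ) (μ σ : ℝ) : Measure (Fin n → ℝ) :=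
  Measure.pi fun _ => gaussianReal μ (Real.toNNReal (σ ^ 2))

/-- The Gaussian recursive training process with `n` samples per round, started at `(μ₀, σ₀)`.
`X (k + 1)` is the data set sampled in round `k + 1` (`X 0` plays no role), and `M k`, `S k` are
the mean and the standard deviation of the model after round `k`.

In the field `sample`, `condDistrib (X (k + 1)) (M k, S k) P` is the conditional law of the data
set of round `k + 1` given the parameters of the model of round `k`. No further conditional
independence of the past is asked for, so that in particular the process in which the conditional
law given the whole past is the same one is covered. -/
structure IsGaussianRecursiveTraining {Ω : Type*} [MeasurableSpace Ω] (P : Measure Ω)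
    [IsProbabilityMeasure P] (n : ℕ) (μ₀ σ₀ : ℝ) (X : ℕ → Ω → (Fin n → ℝ))
    (M S : ℕ → Ω → ℝ) : Prop where
  measurable_data : ∀ k, Measurable (X (k + 1))
  mean_zero : ∀ ω, M 0 ω = μ₀
  std_zero : ∀ ω, S 0 ω = σ₀
  train_mean : ∀ k ω, M (k + 1) ω = sampleMean (X (k + 1) ω)
  train_std : ∀ k ω, S (k + 1) ω = Real.sqrt (sampleVariance (X (k + 1) ω))
  sample : ∀ k, ∀ᵐ θ ∂(P.map fun ω => (M k ω, S k ω)),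
    condDistrib (X (k + 1)) (fun ω => (M k ω, S k ω)) P θ = iidGaussian n θ.1 θ.2

end

/-! One round multiplies the expected standard deviation by `c = E√(sampleVariance)`, taken over `n`
standard normals. Removing the mean projects onto a hyperplane, so `c = E‖w‖ / √(n - 1)` with `w`
standard Gaussian in dimension `n - 1`, a ratio of Gamma values. `Gamma_add_half_div_Gamma_le` at `x
= (n - 1) / 2` bounds it by `exp (-1 / (4n - 1))`. Iterating gives geometric decay of `E[S k]`;
Markov's inequality yields the tail bound, and summability the almost sure limit. -/

/-! ### The Gamma ratio -/

theorem log_Gamma_add_half_le {x : ℝ} (hx : 0 < x) :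
    Real.log (Real.Gamma (x + 1 / 2)) ≤
      Real.log (Real.Gamma x) + Real.log x / 2 := by
  -- Log-convexity at the midpoint of `x` and `x + 1`.
  have h := Real.convexOn_log_Gamma.2 (Set.mem_Ioi.2 hx)
    (Set.mem_Ioi.2 (show 0 < x + 1 by linarith))
    (by norm_num : (0 : ℝ) ≤ 1 / 2) (by norm_num : (0 : ℝ) ≤ 1 / 2) (by norm_num)
  simp only [smul_eq_mul, Function.comp] at h
  rw [Real.Gamma_add_one hx.ne', Real.log_mul hx.ne' (Real.Gamma_pos_of_pos hx).ne'] at h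
  rw [show 1 / 2 * x + 1 / 2 * (x + 1) = x + 1 / 2 by ring] at h
  linarith

/-- The logarithm of `Γ(x + 1/2) / (√x Γ(x)) * exp (1 / (8x + 3))`. -/
noncomputable def logGammaRatioDefect (x : ℝ) : ℝ :=
  Real.log (Real.Gamma (x + 1 / 2)) - Real.log (Real.Gamma x) - Real.log x / 2 + 1 / (8 * x + 3)

/-- The Gamma recursion leaves `log ((x + 1/2)² / (x (x + 1))) / 2` against a difference of rational
terms, and `log t ≥ 1 - 1/t` suffices. -/
theorem logGammaRatioDefect_le_add_one {x : ℝ} (hx : 0 < x) :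
    logGammaRatioDefect x ≤ logGammaRatioDefect (x + 1) := by
  unfold logGammaRatioDefect
  rw [show x + 1 + 1 / 2 = (x + 1 / 2) + 1 by ring, Real.Gamma_add_one hx.ne',
    Real.Gamma_add_one (by positivity), Real.log_mul hx.ne' (Real.Gamma_pos_of_pos hx).ne',
    Real.log_mul (by positivity) (Real.Gamma_pos_of_pos (by positivity)).ne']
  have h := Real.one_sub_inv_le_log_of_pos (x := (x + 1 / 2) ^ 2 / (x * (x + 1))) (by positivity)
  rw [Real.log_div (by positivity) (by positivity), Real.log_pow,
    Real.log_mul (by positivity) (by positivity)] at h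
  have h2 : 1 / (8 * x + 3) - 1 / (8 * (x + 1) + 3) ≤
      (1 - ((x + 1 / 2) ^ 2 / (x * (x + 1)))⁻¹) / 2 := by
    have e1 : 1 / (8 * x + 3) - 1 / (8 * (x + 1) + 3) = 8 / ((8 * x + 3) * (8 * x + 11)) := by
      field_simp; ring
    have e2 : (1 - ((x + 1 / 2) ^ 2 / (x * (x + 1)))⁻¹) / 2 = 8 / (64 * (x + 1 / 2) ^ 2) := by
      field_simp; ring
    rw [e1, e2]
    -- Compares `(8x + 4)²` with `(8x + 3)(8x + 11)`.
    apply div_le_div_of_nonneg_left <;> nlinarith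
  push_cast at h
  linarith

/-- The defect increases along `x + N`, where log-convexity bounds it by a quantity tending to `0`.
-/
theorem logGammaRatioDefect_nonpos {x : ℝ} (hx : 0 < x) : logGammaRatioDefect x ≤ 0 := by
  have h1 (N : ℕ) : logGammaRatioDefect x ≤ logGammaRatioDefect (x + N) := by
    induction N with
    | zero => simp
    | succ N ih =>
      refine ih.trans ((logGammaRatioDefect_le_add_one (by positivity)).trans (le_of_eq ?_))
      push_cast; ring_nf
  have h2 (N : ℕ) : logGammaRatioDefect x ≤ 1 / ((N : ℝ) + 1) := by
    refine (h1 N).trans ?_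
    have h3 := log_Gamma_add_half_le (x := x + N) (by positivity)
    have h4 : 1 / (8 * (x + N) + 3) ≤ 1 / ((N : ℝ) + 1) := by
      apply one_div_le_one_div_of_le (by positivity)
      have : (0 : ℝ) ≤ N := N.cast_nonneg
      linarith
    unfold logGammaRatioDefect
    linarith
  exact ge_of_tendsto' tendsto_one_div_add_atTop_nhds_zero_nat h2

/-- A sharpened form of Wendel's inequality for the ratio `Γ(x + 1/2) / Γ(x)`. -/
theorem Gamma_add_half_div_Gamma_le {x : ℝ} (hx : 0 < x) :
    Real.Gamma (x + 1 / 2) / Real.Gamma x ≤ √x * Real.exp (-(1 / (8 * x + 3))) := by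
  have hG := Real.Gamma_pos_of_pos hx
  have hG' := Real.Gamma_pos_of_pos (show 0 < x + 1 / 2 by positivity)
  have h := logGammaRatioDefect_nonpos hx
  unfold logGammaRatioDefect at h
  rw [← Real.log_le_log_iff (by positivity) (by positivity), Real.log_div hG'.ne' hG.ne',
    Real.log_mul (by positivity) (by positivity), Real.log_exp, Real.log_sqrt hx.le]
  linarith

/-! ### Expected norm of a standard Gaussian vector -/

section StdGaussian

open Module
open scoped RealInnerProductSpace

variable {E : Type*} [NormedAddCommGroup E] [InnerProductSpace ℝ E] [FiniteDimensional ℝ E]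
  [MeasurableSpace E] [BorelSpace E]

theorem integrable_exp_neg_half_sq_norm :
    Integrable (fun x : E => Real.exp (-(1 / 2) * ‖x‖ ^ 2)) := by
  have h := (GaussianFourier.integrable_cexp_neg_mul_sq_norm_add (V := E) (b := ((1 / 2 : ℝ) : ℂ))
    (by rw [Complex.ofReal_re]; norm_num) 0 0).re
  refine h.congr (ae_of_all _ fun x => ?_)
  have : (-((1 / 2 : ℝ) : ℂ) * (‖x‖ : ℂ) ^ 2 + 0 * ((⟪(0 : E), x⟫ : ℝ) : ℂ)) =
      ((-(1 / 2) * ‖x‖ ^ 2 : ℝ) : ℂ) := by push_cast; ring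
  simp only [this]
  exact Complex.exp_ofReal_re _

/-- The standard Gaussian measure has the expected density. -/
theorem stdGaussian_eq_withDensity :
    stdGaussian E = (volume : Measure E).withDensity fun x => ENNReal.ofReal
      ((2 * Real.pi) ^ (-(finrank ℝ E / 2 : ℝ)) * Real.exp (-(1 / 2) * ‖x‖ ^ 2)) := by
  have hfin : IsFiniteMeasure ((volume : Measure E).withDensity fun x => ENNReal.ofReal
      ((2 * Real.pi) ^ (-(finrank ℝ E / 2 : ℝ)) * Real.exp (-(1 / 2) * ‖x‖ ^ 2))) :=
    isFiniteMeasure_withDensity_ofReal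
      (integrable_exp_neg_half_sq_norm.const_mul _).hasFiniteIntegral
  apply Measure.ext_of_charFun
  ext t
  rw [charFun_stdGaussian, charFun_apply, integral_withDensity_eq_integral_toReal_smul
    (by fun_prop) (by simp)]
  have h := GaussianFourier.integral_cexp_neg_mul_sq_norm_add (V := E) (b := ((1 / 2 : ℝ) : ℂ))
    (by rw [Complex.ofReal_re]; norm_num) Complex.I t
  have e1 (x : E) : (ENNReal.ofReal ((2 * Real.pi) ^ (-(finrank ℝ E / 2 : ℝ)) *
        Real.exp (-(1 / 2) * ‖x‖ ^ 2))).toReal • Complex.exp (⟪x, t⟫ * Complex.I) =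
      (((2 * Real.pi) ^ (-(finrank ℝ E / 2 : ℝ)) : ℝ) : ℂ) *
        Complex.exp (-((1 / 2 : ℝ) : ℂ) * ‖x‖ ^ 2 + Complex.I * ⟪t, x⟫) := by
    rw [ENNReal.toReal_ofReal (by positivity), Complex.exp_add, Complex.real_smul,
      real_inner_comm]
    push_cast
    rw [mul_comm Complex.I]
    ring
  simp_rw [e1]
  rw [integral_const_mul, h]
  have e2 : ((Real.pi : ℂ) / ((1 / 2 : ℝ) : ℂ)) ^ (finrank ℝ E / 2 : ℂ) =
      (((2 * Real.pi) ^ (finrank ℝ E / 2 : ℝ) : ℝ) : ℂ) := by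
    rw [Complex.ofReal_cpow (by positivity)]
    push_cast
    congr 1
    ring
  rw [e2, ← mul_assoc, ← Complex.ofReal_mul, ← Real.rpow_add (by positivity)]
  simp only [neg_add_cancel, Real.rpow_zero, Complex.ofReal_one, one_mul, Complex.I_sq]
  congr 1
  push_cast
  ring

theorem integral_fun_norm_stdGaussian [Nontrivial E] (f : ℝ → ℝ) :
    ∫ x, f ‖x‖ ∂(stdGaussian E) =
      (2 * Real.pi) ^ (-(finrank ℝ E / 2 : ℝ)) * (finrank ℝ E *
        ((volume : Measure E).real (Metric.ball 0 1) *
          ∫ y in Set.Ioi (0 : ℝ), y ^ (finrank ℝ E - 1) * (Real.exp (-(1 / 2) * y ^ 2) * f y))) := by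
  rw [stdGaussian_eq_withDensity, integral_withDensity_eq_integral_toReal_smul
    (by fun_prop) (by simp)]
  have e1 (x : E) : (ENNReal.ofReal ((2 * Real.pi) ^ (-(finrank ℝ E / 2 : ℝ)) *
        Real.exp (-(1 / 2) * ‖x‖ ^ 2))).toReal • f ‖x‖ =
      (2 * Real.pi) ^ (-(finrank ℝ E / 2 : ℝ)) * (Real.exp (-(1 / 2) * ‖x‖ ^ 2) * f ‖x‖) := by
    rw [ENNReal.toReal_ofReal (by positivity), smul_eq_mul, mul_assoc]
  simp_rw [e1]
  rw [integral_const_mul, integral_fun_norm_addHaar volume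
    (fun y => Real.exp (-(1 / 2) * y ^ 2) * f y)]
  simp

theorem integral_pow_mul_exp_neg_half_sq (m : ℕ) :
    ∫ y in Set.Ioi (0 : ℝ), y ^ m * Real.exp (-(1 / 2) * y ^ 2) =
      √2 ^ (m + 1) / 2 * Real.Gamma ((m + 1) / 2) := by
  have h := integral_rpow_mul_exp_neg_mul_rpow (p := 2) (q := m) (b := 1 / 2) (by norm_num)
    (by linarith [(Nat.cast_nonneg m : (0 : ℝ) ≤ m)]) (by norm_num)
  simp only [Real.rpow_natCast, Real.rpow_ofNat] at h
  rw [h]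
  congr 1
  rw [Real.sqrt_eq_rpow, ← Real.rpow_mul_natCast (by norm_num), one_div, Real.inv_rpow (by norm_num),
    ← Real.rpow_neg (by norm_num)]
  rw [show -(-((m : ℝ) + 1) / 2) = 2⁻¹ * ((m + 1 : ℕ) : ℝ) by push_cast; ring]
  ring

theorem integral_norm_stdGaussian [Nontrivial E] :
    ∫ x, ‖x‖ ∂(stdGaussian E) =
      √2 * (Real.Gamma (finrank ℝ E / 2 + 1 / 2) / Real.Gamma (finrank ℝ E / 2)) := by
  -- Total mass one eliminates the unknown volume of the unit ball from `h2`.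
  have h1 := integral_fun_norm_stdGaussian (E := E) (fun _ => 1)
  have h2 := integral_fun_norm_stdGaussian (E := E) (fun y => y)
  obtain ⟨m, hm⟩ : ∃ m, finrank ℝ E = m + 1 := ⟨_, (Nat.succ_pred finrank_pos.ne').symm⟩
  simp only [integral_const, probReal_univ, smul_eq_mul, mul_one, hm, Nat.add_sub_cancel] at h1 h2 ⊢
  have e (y : ℝ) : y ^ m * (Real.exp (-(1 / 2) * y ^ 2) * y) =
    y ^ (m + 1) * Real.exp (-(1 / 2) * y ^ 2) := by ring
  simp_rw [e] at h2
  rw [integral_pow_mul_exp_neg_half_sq] at h1 h2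
  rw [h2]
  push_cast at h1 ⊢
  have hG := Real.Gamma_pos_of_pos (show 0 < ((m : ℝ) + 1) / 2 by positivity)
  rw [mul_div_assoc', eq_div_iff hG.ne', show ((m : ℝ) + 1) / 2 + 1 / 2 = (m + 1 + 1) / 2 by ring]
  linear_combination -√2 * Real.Gamma ((m + 1 + 1) / 2) * h1

theorem integral_norm_stdGaussian_le [Nontrivial E] :
    ∫ x, ‖x‖ ∂(stdGaussian E) ≤
      √(finrank ℝ E) * Real.exp (-(1 / (4 * finrank ℝ E + 3))) := by
  have hd : (0 : ℝ) < finrank ℝ E := by exact_mod_cast finrank_pos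
  rw [integral_norm_stdGaussian]
  refine (mul_le_mul_of_nonneg_left
    (Gamma_add_half_div_Gamma_le (half_pos hd)) (Real.sqrt_nonneg 2)).trans (le_of_eq ?_)
  rw [← mul_assoc, ← Real.sqrt_mul (by norm_num)]
  ring_nf

/-- The projection is adjoint to the isometric inclusion of `W`, so the characteristic functions
agree. -/
theorem map_orthogonalProjectionOnto_stdGaussian (W : Submodule ℝ E) :
    (stdGaussian E).map W.orthogonalProjectionOnto = stdGaussian W := by
  apply Measure.ext_of_charFun
  ext t
  rw [charFun_stdGaussian, charFun_apply, integral_map (by fun_prop) (by fun_prop)]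
  simp_rw [Submodule.inner_orthogonalProjectionOnto_eq_of_mem_right]
  rw [← charFun_apply, charFun_stdGaussian]
  simp

end StdGaussian

/-! ### Sample variance as a squared projection -/

section SampleVariance

open Module
open scoped RealInnerProductSpace

variable {n : ℕ}

theorem measurable_sampleMean : Measurable (sampleMean : (Fin n → ℝ) → ℝ) := by
  unfold sampleMean
  fun_prop

theorem measurable_sampleVariance : Measurable (sampleVariance : (Fin n → ℝ) → ℝ) := by
  unfold sampleVariance
  have := measurable_sampleMean (n := n)
  fun_prop

theorem sampleMean_affine (hn : n ≠ 0) (μ σ : ℝ) (x : Fin n → ℝ) :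
    sampleMean (fun i => μ + σ * x i) = μ + σ * sampleMean x := by
  have : (n : ℝ) ≠ 0 := by exact_mod_cast hn
  simp only [sampleMean, Finset.sum_add_distrib, ← Finset.mul_sum, Finset.sum_const,
    Finset.card_univ, Fintype.card_fin, nsmul_eq_mul]
  field_simp

theorem sqrt_sampleVariance_affine (hn : n ≠ 0) (μ σ : ℝ) (x : Fin n → ℝ) :
    √(sampleVariance fun i => μ + σ * x i) = |σ| * √(sampleVariance x) := by
  have h : (sampleVariance fun i => μ + σ * x i) = σ ^ 2 * sampleVariance x := by
    simp only [sampleVariance, sampleMean_affine hn, mul_div_assoc', Finset.mul_sum]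
    congr 1
    exact Finset.sum_congr rfl fun i _ => by ring
  rw [h, Real.sqrt_mul (sq_nonneg σ), Real.sqrt_sq_eq_abs]

/-- The vectors of `ℝⁿ` whose coordinates sum to zero. -/
noncomputable def centeredSubspace (n : ℕ) : Submodule ℝ (EuclideanSpace ℝ (Fin n)) :=
  (ℝ ∙ (WithLp.toLp 2 fun _ => 1 : EuclideanSpace ℝ (Fin n)))ᗮ

theorem finrank_centeredSubspace (m : ℕ) : finrank ℝ (centeredSubspace (m + 1)) = m := by
  have : Fact (finrank ℝ (EuclideanSpace ℝ (Fin (m + 1))) = m + 1) := ⟨by simp⟩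
  refine Submodule.finrank_orthogonal_span_singleton fun h => ?_
  simpa using congrArg (fun v : EuclideanSpace ℝ (Fin (m + 1)) => v 0) h

theorem norm_sq_projection_centeredSubspace (x : Fin n → ℝ) :
    ‖(centeredSubspace n).orthogonalProjectionOnto (WithLp.toLp 2 x)‖ ^ 2 =
      ∑ i, (x i - sampleMean x) ^ 2 := by
  rw [Submodule.coe_norm, ← Submodule.starProjection_apply, centeredSubspace,
    Submodule.starProjection_orthogonal_val, Submodule.starProjection_singleton,
    EuclideanSpace.real_norm_sq_eq]
  refine Finset.sum_congr rfl fun i _ => ?_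
  simp [sampleMean, PiLp.inner_apply, EuclideanSpace.real_norm_sq_eq]

theorem sqrt_sampleVariance_eq (x : Fin n → ℝ) :
    √(sampleVariance x) =
      ‖(centeredSubspace n).orthogonalProjectionOnto (WithLp.toLp 2 x)‖ / √((n : ℝ) - 1) := by
  rw [sampleVariance, ← norm_sq_projection_centeredSubspace, Real.sqrt_div (sq_nonneg _),
    Real.sqrt_sq (norm_nonneg _)]

/-- Reduces every model, including the degenerate case `σ = 0`, to standard normals. -/
theorem iidGaussian_eq_map (μ σ : ℝ) :
    iidGaussian n μ σ =
      (Measure.pi fun _ : Fin n => gaussianReal 0 1).map fun x i => μ + σ * x i := by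
  have h : (gaussianReal 0 1).map (fun x => μ + σ * x) =
      gaussianReal μ (Real.toNNReal (σ ^ 2)) := by
    rw [show (fun x : ℝ => μ + σ * x) = (fun x => μ + x) ∘ fun x => σ * x from rfl,
      ← Measure.map_map (by fun_prop) (by fun_prop), gaussianReal_map_const_mul,
      gaussianReal_map_const_add]
    congr 1
    · simp
    · rw [mul_one]
      ext
      simp [sq_nonneg]
  have hprob : IsProbabilityMeasure ((gaussianReal 0 1).map fun x => μ + σ * x) := by
    rw [h]; infer_instance
  rw [Measure.pi_map_pi (f := fun _ x => μ + σ * x) fun _ => by fun_prop]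
  simp only [h, iidGaussian]

theorem lintegral_sqrt_sampleVariance_pi_le (hn : 2 ≤ n) :
    ∫⁻ x, ENNReal.ofReal √(sampleVariance x) ∂(Measure.pi fun _ : Fin n => gaussianReal 0 1) ≤
      ENNReal.ofReal (Real.exp (-(1 / (4 * (n : ℝ) - 1)))) := by
  obtain ⟨m, rfl⟩ : ∃ m, n = m + 1 := ⟨n - 1, by omega⟩
  have hm : (0 : ℝ) < m := by exact_mod_cast (show 0 < m by omega)
  have hfr := finrank_centeredSubspace m
  -- The polar-coordinate formula needs positive dimension, hence `2 ≤ n`.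
  have : Nontrivial (centeredSubspace (m + 1)) :=
    Module.nontrivial_of_finrank_pos (R := ℝ) (by omega)
  have hint : Integrable (fun w : centeredSubspace (m + 1) => ‖w‖) (stdGaussian _) :=
    IsGaussian.integrable_id.norm
  have h1 : ∫⁻ x, ENNReal.ofReal √(sampleVariance x)
        ∂(Measure.pi fun _ : Fin (m + 1) => gaussianReal 0 1) =
      ∫⁻ w, ENNReal.ofReal (‖w‖ / √m) ∂(stdGaussian (centeredSubspace (m + 1))) := by
    rw [← map_orthogonalProjectionOnto_stdGaussian, ← map_pi_eq_stdGaussian,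
      lintegral_map (by fun_prop) (by fun_prop), lintegral_map (by fun_prop) (by fun_prop)]
    simp [sqrt_sampleVariance_eq]
  rw [h1, ← ofReal_integral_eq_lintegral_ofReal (hint.div_const _)
    (ae_of_all _ fun _ => by positivity), integral_div]
  apply ENNReal.ofReal_le_ofReal
  rw [div_le_iff₀ (by positivity)]
  refine integral_norm_stdGaussian_le.trans (le_of_eq ?_)
  -- With dimension `m = n - 1`, `4m + 3 = 4n - 1`.
  rw [hfr, mul_comm]
  push_cast
  ring_nf

theorem lintegral_sqrt_sampleVariance_iidGaussian_le (hn : 2 ≤ n) (μ σ : ℝ) :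
    ∫⁻ x, ENNReal.ofReal √(sampleVariance x) ∂(iidGaussian n μ σ) ≤
      ENNReal.ofReal (Real.exp (-(1 / (4 * (n : ℝ) - 1)))) * ENNReal.ofReal |σ| := by
  have hmeas := measurable_sampleVariance (n := n)
  rw [iidGaussian_eq_map, lintegral_map (by fun_prop) (by fun_prop)]
  simp_rw [sqrt_sampleVariance_affine (show n ≠ 0 by omega), ENNReal.ofReal_mul (abs_nonneg σ)]
  rw [lintegral_const_mul _ (by fun_prop), mul_comm]
  gcongr
  exact lintegral_sqrt_sampleVariance_pi_le hn

end SampleVariance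

/-! ### Decay of the process -/

namespace IsGaussianRecursiveTraining

variable {Ω : Type*} [MeasurableSpace Ω] {P : Measure Ω} [IsProbabilityMeasure P] {n : ℕ}
  {μ₀ σ₀ : ℝ} {X : ℕ → Ω → (Fin n → ℝ)} {M S : ℕ → Ω → ℝ}

theorem measurable_mean (h : IsGaussianRecursiveTraining P n μ₀ σ₀ X M S) (k : ℕ) :
    Measurable (M k) := by
  cases k with
  | zero => exact (funext h.mean_zero : M 0 = fun _ => μ₀) ▸ measurable_const
  | succ k =>
    rw [show M (k + 1) = fun ω => sampleMean (X (k + 1) ω) from funext (h.train_mean k)]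
    exact measurable_sampleMean.comp (h.measurable_data k)

theorem measurable_std (h : IsGaussianRecursiveTraining P n μ₀ σ₀ X M S) (k : ℕ) :
    Measurable (S k) := by
  cases k with
  | zero => exact (funext h.std_zero : S 0 = fun _ => σ₀) ▸ measurable_const
  | succ k =>
    rw [show S (k + 1) = fun ω => √(sampleVariance (X (k + 1) ω)) from funext (h.train_std k)]
    exact (measurable_sampleVariance.comp (h.measurable_data k)).sqrt

theorem std_nonneg (h : IsGaussianRecursiveTraining P n μ₀ σ₀ X M S) (hσ₀ : 0 ≤ σ₀) (k : ℕ)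
    (ω : Ω) : 0 ≤ S k ω := by
  cases k with
  | zero => rwa [h.std_zero]
  | succ k => rw [h.train_std]; exact Real.sqrt_nonneg _

theorem lintegral_std_succ_le (h : IsGaussianRecursiveTraining P n μ₀ σ₀ X M S) (hn : 2 ≤ n)
    (hσ₀ : 0 ≤ σ₀) (k : ℕ) :
    ∫⁻ ω, ENNReal.ofReal (S (k + 1) ω) ∂P ≤
      ENNReal.ofReal (Real.exp (-(1 / (4 * (n : ℝ) - 1)))) *
        ∫⁻ ω, ENNReal.ofReal (S k ω) ∂P := by
  have hX := h.measurable_data k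
  have hM := h.measurable_mean k
  have hS := h.measurable_std k
  have hV := measurable_sampleVariance (n := n)
  calc ∫⁻ ω, ENNReal.ofReal (S (k + 1) ω) ∂P
      = ∫⁻ z, ENNReal.ofReal √(sampleVariance z.2)
          ∂(P.map fun ω => ((M k ω, S k ω), X (k + 1) ω)) := by
        rw [lintegral_map (by fun_prop) (by fun_prop)]
        simp only [h.train_std]
    _ = ∫⁻ θ, ∫⁻ x, ENNReal.ofReal √(sampleVariance x)
          ∂(condDistrib (X (k + 1)) (fun ω => (M k ω, S k ω)) P θ)
          ∂(P.map fun ω => (M k ω, S k ω)) := by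
        -- Disintegration over the current parameters: the one-step conditional law is enough for
        -- expectations.
        rw [← compProd_map_condDistrib hX.aemeasurable, Measure.lintegral_compProd (by fun_prop)]
    _ ≤ ∫⁻ θ, ENNReal.ofReal (Real.exp (-(1 / (4 * (n : ℝ) - 1)))) * ENNReal.ofReal |θ.2|
          ∂(P.map fun ω => (M k ω, S k ω)) := by
        refine lintegral_mono_ae ?_
        filter_upwards [h.sample k] with θ hθ
        rw [hθ]
        exact lintegral_sqrt_sampleVariance_iidGaussian_le hn _ _
    _ = _ := by
        rw [lintegral_map (by fun_prop) (by fun_prop), lintegral_const_mul _ (by fun_prop)]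
        simp only [abs_of_nonneg (h.std_nonneg hσ₀ k _)]

theorem lintegral_std_le (h : IsGaussianRecursiveTraining P n μ₀ σ₀ X M S) (hn : 2 ≤ n)
    (hσ₀ : 0 ≤ σ₀) (k : ℕ) :
    ∫⁻ ω, ENNReal.ofReal (S k ω) ∂P ≤
      ENNReal.ofReal (Real.exp (-(1 / (4 * (n : ℝ) - 1)))) ^ k * ENNReal.ofReal σ₀ := by
  induction k with
  | zero => simp [h.std_zero]
  | succ k ih =>
    refine (h.lintegral_std_succ_le hn hσ₀ k).trans ?_
    rw [pow_succ', mul_assoc]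
    gcongr

theorem measureReal_lt_std_le (h : IsGaussianRecursiveTraining P n μ₀ σ₀ X M S) (hn : 2 ≤ n)
    (hσ₀ : 0 ≤ σ₀) (k : ℕ) {ε : ℝ} (hε : 0 < ε) :
    P.real {ω | ε < S k ω} ≤ σ₀ / ε * Real.exp (-((k : ℝ) / (4 * (n : ℝ) - 1))) := by
  have hS := h.measurable_std k
  have hsub : {ω | ε < S k ω} ⊆ {ω | ENNReal.ofReal ε ≤ ENNReal.ofReal (S k ω)} :=
    fun ω hω => ENNReal.ofReal_le_ofReal (le_of_lt hω)
  have hmk := (measure_mono hsub).trans (meas_ge_le_lintegral_div (μ := P)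
    (f := fun ω => ENNReal.ofReal (S k ω)) (by fun_prop)
    (ENNReal.ofReal_pos.2 hε).ne' ENNReal.ofReal_ne_top)
  refine ENNReal.toReal_le_of_le_ofReal (by positivity) (hmk.trans ?_)
  refine (ENNReal.div_le_div_right (h.lintegral_std_le hn hσ₀ k) _).trans (le_of_eq ?_)
  rw [← ENNReal.ofReal_pow (by positivity), ← ENNReal.ofReal_mul (by positivity),
    ← ENNReal.ofReal_div_of_pos hε, ← Real.exp_nat_mul]
  ring_nf

theorem tendsto_std (h : IsGaussianRecursiveTraining P n μ₀ σ₀ X M S) (hn : 2 ≤ n)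
    (hσ₀ : 0 ≤ σ₀) : ∀ᵐ ω ∂P, Tendsto (fun k => S k ω) atTop (𝓝 0) := by
  have hS := h.measurable_std
  have hlt : ENNReal.ofReal (Real.exp (-(1 / (4 * (n : ℝ) - 1)))) < 1 := by
    have : (2 : ℝ) ≤ n := by exact_mod_cast hn
    rw [ENNReal.ofReal_lt_one, Real.exp_lt_one_iff, neg_lt_zero]
    exact one_div_pos.2 (by linarith)
  -- The expectations are dominated by a geometric series, so `∑ S k` is almost surely finite and
  -- its terms tend to `0`.
  have hsum : ∫⁻ ω, ∑' k, ENNReal.ofReal (S k ω) ∂P ≠ ⊤ := by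
    rw [lintegral_tsum fun k => by fun_prop]
    refine ne_top_of_le_ne_top ?_ (ENNReal.tsum_le_tsum (h.lintegral_std_le hn hσ₀))
    rw [ENNReal.tsum_mul_right, ENNReal.tsum_geometric]
    exact ENNReal.mul_ne_top (ENNReal.inv_ne_top.2 (tsub_pos_of_lt hlt).ne') ENNReal.ofReal_ne_top
  filter_upwards [ae_lt_top (by fun_prop) hsum] with ω hω
  have ht := (ENNReal.tendsto_toReal ENNReal.zero_ne_top).comp
    (ENNReal.tendsto_atTop_zero_of_tsum_ne_top hω.ne)
  simpa [Function.comp_def, ENNReal.toReal_ofReal (h.std_nonneg hσ₀ _ ω)] using ht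

end IsGaussianRecursiveTraining

theorem theorem3 {Ω : Type*} [MeasurableSpace Ω] (P : Measure Ω) [IsProbabilityMeasure P]
    (n : ℕ) (hn : 3 ≤ n) (μ₀ σ₀ : ℝ) (hσ₀ : 0 ≤ σ₀)
    (X : ℕ → Ω → (Fin n → ℝ)) (M S : ℕ → Ω → ℝ)
    (h : IsGaussianRecursiveTraining P n μ₀ σ₀ X M S) :
    (∀ (k : ℕ) (ε : ℝ), 0 < ε →
      P.real {ω | ε < S k ω} ≤ σ₀ / ε * Real.exp (-((k : ℝ) / (4 * (n : ℝ) - 1)))) ∧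
    (∀ᵐ ω ∂P, Tendsto (fun k => S k ω) atTop (𝓝 0)) := by
  exact ⟨fun k _ hε => h.measureReal_lt_std_le (by omega) hσ₀ k hε,
    h.tendsto_std (by omega) hσ₀⟩
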